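/- Let $G$ be a finite graph (loops, multiple edges and disconnected graphs are allowed) with an arbitrary linear ordering of its edges, let $q\ge 1$ be an integer and let $\beta,J,H\in\mathbb{C}$. For a finite graph $K$ with vertex weights $z=(z_v)_{v\in V(K)}$, $z_v\in\mathbb{C}$, let $$Z(K,z)=\sum_{\sigma:V(K)\to\{1,\dots,q\}}e^{-\beta h(\sigma)},\qquad h(\sigma)=-J\sum_{e=\{u,v\}\in E(K)}\delta(\sigma_u,\sigma_v)-\sum_{v\in V(K)}z_v\,\delta(1,\sigma_v),$$ and let $Z(G)$ be the value of $Z(G,z)$ for the constant field $z_v=H$, that is, for the Hamiltonian $h(\sigma)=-J\sum_{\{u,v\}\in E(G)}\delta(\sigma_u,\sigma_v)-H\sum_{v\in V(G)}\delta(1,\sigma_v)$. Then the following three expansions hold. 1. (Connected partitions.) For every $B\subseteq V(G)$ there is a polynomial $P_B$ (necessarily unique) such that, for every $n\in\mathbb{N}$, $P_B(n)$ is the zero-field $n$-state Potts partition function $Z_{zero}(G[B];n,e^{\beta J}-1)=\sum_{\sigma:B\to\{1,\dots,n\}}\exp\bigl(\beta J\sum_{\{u,v\}\in E(G[B])}\delta(\sigma_u,\sigma_v)\bigr)$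 of the induced subgraph $G[B]$, and $$Z(G)=\sum_{\pi}\ \prod_{B\in\pi}\bigl(e^{\beta H|B|}+q-1\bigr)\ \prod_{B\in\pi}[x^1]P_B(x),$$ where $\pi$ runs over the partitions of $V(G)$ all of whose blocks induce connected subgraphs, and $[x^1]$ denotes the coefficient of $x$. 2. (Spanning forests.) $$Z(G)=\sum_{F}\ \prod_{i}\bigl(e^{\beta H|V(F_i)|}+q-1\bigr)\ \prod_{e\in F}\bigl(e^{\beta J}-1\bigr)\prod_{e\in\mathcal{E_A}(G,F)}e^{\beta J},$$ where $F$ runs over the spanning forests (acyclic spanning subgraphs) of $G$, the $F_i$ are the components of $F$, and $\mathcal{E_A}(G,F)$ is the set of edges $e\notin F$ such that $F\cup e$ contains a cycle and $e$ is the smallest edge of that cycle. 3. (Spanning trees.) $$Z(G)=\sum_{T}\ \prod_{e\in\mathcal{I_I}(G,T)}\bigl(e^{\beta J}-1\bigr)\prod_{e\in\mathcal{E_A}(G,T)}e^{\beta J}\ \cdot Z\bigl(T/\mathcal{I_I}(G,T),z_T\bigr),$$ where $T$ runs over the spanning trees of $G$ (spanning forests whose restriction to each component of $G$ is a spanning tree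 of that component), $\mathcal{I_I}(G,T)$ is the set of edges $e\in T$ that are not the smallest edge of the cut $\{f\in E(G): (T-e)\cup f \text{ is a spanning tree of } G\}$, and $T/\mathcal{I_I}(G,T)$ is the contraction as a vertex-weighted graph: the field $z_T$ at a vertex obtained by merging $m$ vertices of $G$ is the sum $mH$ of their fields. -/

import Mathlib

open scoped Graph Polynomial

namespace Graph

noncomputable section

variable {α ε : Type*}

/-! ### Connectivity of multigraphs -/

/-- `y` can be reached from `x` by a walk in `G`. -/
def Reachable (G : Graph α ε) (x y : α) : Prop :=
  Relation.ReflTransGen G.Adj x y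

/-- `G` is connected: it has a vertex and any two vertices are joined by a walk. -/
def IsConnected (G : Graph α ε) : Prop :=
  V(G).Nonempty ∧ ∀ x ∈ V(G), ∀ y ∈ V(G), G.Reachable x y

/-- The vertex set of the connected component of `G` that contains `x`. -/
def component (G : Graph α ε) (x : α) : Set α :=
  {y | y ∈ V(G) ∧ G.Reachable x y}

/-- The vertex sets of the connected components of `G`. -/
def components (G : Graph α ε) : Set (Set α) :=
  G.component '' V(G)

/-- A partition of the vertex set is connected if each block induces a connected subgraph. -/
def IsConnectedPartition (G : Graph α ε) (π : Partition V(G)) : Prop :=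
  ∀ B ∈ π, (G.induce B).IsConnected

/-! ### Cycles, spanning forests and spanning trees

Spanning subgraphs are identified with their edge sets. -/

/-- `C` is the edge set of a cycle of `G` with distinct vertices `v 0, …, v n` and distinct edges
`e 0, …, e n`, where `e i` joins `v i` to `v (i + 1)` and `i + 1` is computed cyclically. A loop is
a cycle with one edge; two parallel edges form a cycle with two edges. -/
def IsCycle (G : Graph α ε) (C : Set ε) : Prop :=
  ∃ (n : ℕ) (v : Fin (n + 1) → α) (e : Fin (n + 1) → ε),
    Function.Injective v ∧ Function.Injective e ∧
    (∀ i, G.IsLink (e i) (v i) (v (i + 1))) ∧ C = Set.range e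

/-- `F` is (the edge set of) a spanning forest of `G`: an acyclic spanning subgraph. -/
def IsSpanningForest (G : Graph α ε) (F : Set ε) : Prop :=
  F ⊆ E(G) ∧ ∀ C ⊆ F, ¬ G.IsCycle C

/-- `T` is (the edge set of) a spanning tree of the possibly disconnected graph `G`: a spanning
forest that connects any two vertices lying in the same component of `G`, so that it restricts to a
spanning tree of each component. -/
def IsSpanningTree (G : Graph α ε) (T : Set ε) : Prop :=
  G.IsSpanningForest T ∧
    ∀ x ∈ V(G), ∀ y ∈ V(G), G.Reachable x y → (G.restrict T).Reachable x y

/-! ### Edge activities -/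

/-- The cut defined by an edge `e` of a spanning tree `T`. -/
def cut (G : Graph α ε) (T : Set ε) (e : ε) : Set ε :=
  {f | f ∈ E(G) ∧ G.IsSpanningTree (insert f (T \ {e}))}

/-- The internally inactive edges of `G` with respect to the spanning tree `T`: those edges of `T`
that are not the smallest edge in the cut which they define. -/
def internallyInactive [LinearOrder ε] (G : Graph α ε) (T : Set ε) : Set ε :=
  {e | e ∈ T ∧ ¬ IsLeast (G.cut T e) e}

/-- The externally active edges of `G` with respect to the spanning forest `F`: those edges
`e ∉ F` such that `F ∪ {e}` contains a (necessarily unique) cycle, in which `e` is the smallest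
edge. -/
def externallyActive [LinearOrder ε] (G : Graph α ε) (F : Set ε) : Set ε :=
  {e | e ∈ E(G) ∧ e ∉ F ∧ ∃ C ⊆ insert e F, G.IsCycle C ∧ IsLeast C e}

/-! ### Contraction of vertex-weighted graphs -/

/-- `G / C` for an acyclic set `C` of edges: the edges in `C` are removed and the vertices of each
component of `(V(G), C)` are merged. The merged vertex is named by the set of vertices of `G` from
which it arises. -/
def contract (G : Graph α ε) (C : Set ε) : Graph (Set α) ε :=
  (G.deleteEdges C).map (G.restrict C).component

/-- The vertex weights of a contraction: the weight of a merged vertex is the sum of the weights of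
the vertices of the original graph from which it arises. -/
def mergedWeight (z : α → ℂ) (S : Set α) : ℂ :=
  ∑ᶠ v ∈ S, z v

/-! ### The Potts model -/

open Classical in
/-- The value `δ(σ_i, σ_j)` for an edge `e = {i, j}`; it is `1` for a loop. -/
def edgeDelta (G : Graph α ε) {q : ℕ} (σ : V(G) → Fin q) (e : ε) : ℂ :=
  if ∀ x y : V(G), G.IsLink e x y → σ x = σ y then 1 else 0

/-- The Hamiltonian `h(σ) = - J ∑_{{i,j} ∈ E} δ(σ_i, σ_j) - ∑_i z_i δ(1, σ_i)` of the `q`-state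
Potts model with coupling `J` and with the field `z v` at the vertex `v`. The spins `1, …, q` are
represented by `0, …, q - 1` in `Fin q`, so the distinguished spin is `0`. -/
def pottsHamiltonian (G : Graph α ε) {q : ℕ} (J : ℂ) (z : α → ℂ) (σ : V(G) → Fin q) : ℂ :=
  - J * (∑ᶠ e ∈ E(G), G.edgeDelta σ e)
    - ∑ᶠ v : V(G), z v * (if (σ v : ℕ) = 0 then 1 else 0)

/-- The `q`-state Potts model partition function `Z(G) = ∑_σ exp (-β h(σ))`. -/
def pottsZ (G : Graph α ε) (q : ℕ) (β J : ℂ) (z : α → ℂ) : ℂ :=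
  ∑ᶠ σ : V(G) → Fin q, Complex.exp (-β * G.pottsHamiltonian J z σ)

/-- `P` is the zero-field partition function of `G` as a polynomial in the number of spins. -/
def IsZeroFieldPolynomial (G : Graph α ε) (β J : ℂ) (P : ℂ[X]) : Prop :=
  ∀ n : ℕ, P.eval (n : ℂ) = G.pottsZ n β J 0

/-- There is at most one such polynomial, so its coefficients are well defined. -/
theorem IsZeroFieldPolynomial.unique {G : Graph α ε} {β J : ℂ} {P Q : ℂ[X]}
    (hP : G.IsZeroFieldPolynomial β J P) (hQ : G.IsZeroFieldPolynomial β J Q) : P = Q := by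
  refine Polynomial.eq_of_infinite_eval_eq P Q ?_
  refine (Set.infinite_range_of_injective (Nat.cast_injective (R := ℂ))).mono ?_
  rintro _ ⟨n, rfl⟩
  exact (hP n).trans (hQ n).symm

end

end Graph

/-! Put `w = exp (β * J) - 1`. Expanding one factor `1 + w δ` per edge gives the random cluster sum
of `w ^ |A| * constrainedZ A` over all `A ⊆ E(G)`. The factor `constrainedZ A` depends only on the
components of `(V(G), A)` and, for a constant field, is the product of `exp (β H |S|) + q - 1` over
them. Each expansion groups the sum along a map.

Partitions: group by `componentPartition`. A fibre factorises over the blocks `B` into sums over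
connected spanning edge sets of `G[B]`, which are the linear coefficients of the zero-field
polynomials.

Forests: group by `greatestForest`. The fibre over `F` is the interval `[F, F ∪ externallyActive
F]`, on which `constrainedZ` is constant, so the binomial theorem sums it.

Trees: group the forests by `leastTree`. The fibre over `T` is `[internallyInactive T, T]`, on which
`externallyActive` is constant; what remains is the random cluster sum of the contracted tree.

Both interval descriptions are matroid arguments, run through `edgeClosure` and its exchange
property. -/

namespace Graph

noncomputable section

variable {α ε : Type*}

/-! ### Closure and exchange in the cycle matroid -/

section Closure

variable {G : Graph α ε} {A B : Set ε} {e f : ε} {x y z : α}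

lemma Reachable.refl (G : Graph α ε) (x : α) : G.Reachable x x := Relation.ReflTransGen.refl

lemma Reachable.trans (h : G.Reachable x y) (h' : G.Reachable y z) : G.Reachable x z :=
  Relation.ReflTransGen.trans h h'

lemma Reachable.symm (h : G.Reachable x y) : G.Reachable y x :=
  Relation.ReflTransGen.stdSymm.symm _ _ h

lemma IsLink.reachable_restrict (h : G.IsLink e x y) (he : e ∈ A) :
    (G.restrict A).Reachable x y :=
  Relation.ReflTransGen.single ⟨e, he, h⟩

/-- A relation that is reflexive, transitive and holds along the edges in `A` holds between any two
vertices joined by a walk in `A`. -/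
lemma Reachable.of_rel {r : α → α → Prop} (hr : ∀ x, r x x)
    (ht : ∀ x y z, r x y → r y z → r x z)
    (hl : ∀ e ∈ A, ∀ x y, G.IsLink e x y → r x y)
    (h : (G.restrict A).Reachable x y) : r x y := by
  induction h with
  | refl => exact hr _
  | tail _ h ih =>
    obtain ⟨e, he, h⟩ := h
    exact ht _ _ _ ih (hl e he _ _ h)

lemma Reachable.restrict_mono (hAB : A ⊆ B) (h : (G.restrict A).Reachable x y) :
    (G.restrict B).Reachable x y :=
  h.of_rel (Reachable.refl _) (fun _ _ _ => .trans)
    fun _ he _ _ hl => hl.reachable_restrict (hAB he)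

variable (G) in
/-- The edges of `G` whose ends are joined by a walk that uses only edges in `A`. -/
def edgeClosure (A : Set ε) : Set ε :=
  {e | ∃ x y, G.IsLink e x y ∧ (G.restrict A).Reachable x y}

lemma IsLink.mem_edgeClosure_iff (h : G.IsLink e x y) :
    e ∈ G.edgeClosure A ↔ (G.restrict A).Reachable x y := by
  refine ⟨?_, fun h' => ⟨x, y, h, h'⟩⟩
  rintro ⟨u, v, h', huv⟩
  obtain ⟨rfl, rfl⟩ | ⟨rfl, rfl⟩ := h.eq_and_eq_or_eq_and_eq h'
  exacts [huv, huv.symm]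

lemma edgeClosure_subset_edgeSet : G.edgeClosure A ⊆ E(G) := fun _ ⟨_, _, h, _⟩ => h.edge_mem

lemma subset_edgeClosure (hA : A ⊆ E(G)) : A ⊆ G.edgeClosure A := by
  intro e he
  obtain ⟨x, y, h⟩ := exists_isLink_of_mem_edgeSet (hA he)
  exact ⟨x, y, h, h.reachable_restrict he⟩

lemma edgeClosure_mono (hAB : A ⊆ B) : G.edgeClosure A ⊆ G.edgeClosure B :=
  fun _ ⟨x, y, h, h'⟩ => ⟨x, y, h, h'.restrict_mono hAB⟩

lemma Reachable.of_subset_edgeClosure (hAB : A ⊆ G.edgeClosure B)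
    (h : (G.restrict A).Reachable x y) : (G.restrict B).Reachable x y :=
  h.of_rel (Reachable.refl _) (fun _ _ _ => .trans)
    fun _ he _ _ hl => hl.mem_edgeClosure_iff.1 (hAB he)

lemma edgeClosure_subset_edgeClosure (hAB : A ⊆ G.edgeClosure B) :
    G.edgeClosure A ⊆ G.edgeClosure B :=
  fun _ ⟨x, y, h, h'⟩ => ⟨x, y, h, h'.of_subset_edgeClosure hAB⟩

/-- A walk need cross `e` at most once: a second crossing in the same direction can be cut out
together with what precedes it back to the first, and one in the opposite direction returns to an
end already reached without `e`. -/
lemma Reachable.of_insert (h : (G.restrict (insert e A)).Reachable x y) :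
    (G.restrict A).Reachable x y ∨ ∃ u v, G.IsLink e u v ∧
      (G.restrict A).Reachable x u ∧ (G.restrict A).Reachable v y := by
  induction h with
  | refl => exact .inl (.refl _ _)
  | tail _ h ih =>
    obtain ⟨f, hf, h⟩ := h
    obtain rfl | hf := hf
    · obtain ih | ⟨u, v, huv, hxu, hvy⟩ := ih
      · exact .inr ⟨_, _, h, ih, .refl _ _⟩
      · obtain ⟨rfl, rfl⟩ | ⟨rfl, rfl⟩ := huv.eq_and_eq_or_eq_and_eq h
        · exact .inr ⟨_, _, h, hxu, .refl _ _⟩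
        · exact .inl hxu
    · obtain ih | ⟨u, v, huv, hxu, hvy⟩ := ih
      · exact .inl (ih.trans (h.reachable_restrict hf))
      · exact .inr ⟨u, v, huv, hxu, hvy.trans (h.reachable_restrict hf)⟩

lemma mem_edgeClosure_exchange (hf : f ∈ G.edgeClosure (insert e A))
    (hf' : f ∉ G.edgeClosure A) : e ∈ G.edgeClosure (insert f A) := by
  obtain ⟨x, y, hl, h⟩ := hf
  obtain h | ⟨u, v, huv, hxu, hvy⟩ := h.of_insert
  · exact absurd (hl.mem_edgeClosure_iff.2 h) hf'
  · have hs : A ⊆ insert f A := Set.subset_insert _ _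
    exact ⟨u, v, huv, (hxu.symm.restrict_mono hs).trans
      ((hl.reachable_restrict (Set.mem_insert _ _)).trans (hvy.symm.restrict_mono hs))⟩

end Closure

/-! ### Cycles, forests and trees in terms of closure -/

section Cycle

variable {G : Graph α ε} {A C F T : Set ε} {e f : ε} {x y : α}

lemma IsCycle.finite (hC : G.IsCycle C) : C.Finite := by
  obtain ⟨n, v, d, -, -, hl, rfl⟩ := hC
  exact Set.finite_range d

lemma IsCycle.nonempty (hC : G.IsCycle C) : C.Nonempty := by
  obtain ⟨n, v, d, -, -, hl, rfl⟩ := hC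
  exact Set.range_nonempty d

open Fin.NatCast Fin.CommRing in
lemma IsCycle.mem_edgeClosure_diff (hC : G.IsCycle C) (he : e ∈ C) :
    e ∈ G.edgeClosure (C \ {e}) := by
  obtain ⟨n, v, d, -, hd, hl, rfl⟩ := hC
  obtain ⟨i, rfl⟩ := he
  have key : ∀ k : ℕ, k ≤ n →
      (G.restrict (Set.range d \ {d i})).Reachable (v (i + 1)) (v (i + 1 + (k : Fin (n + 1)))) := by
    intro k
    induction k with
    | zero => intro _; simpa using Reachable.refl _ _
    | succ k ih =>
      intro hk
      refine (ih (by omega)).trans ?_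
      -- Equality would force `n + 1 ∣ k + 1`, impossible for `k < n`: going round from `v (i + 1)`
      -- to `v i` avoids `d i`.
      have hne : d (i + 1 + (k : Fin (n + 1))) ≠ d i := by
        intro h
        have h2 : ((k + 1 : ℕ) : Fin (n + 1)) = 0 := by
          have h1 := hd h
          rw [add_assoc, add_eq_left] at h1
          push_cast
          exact (add_comm _ _).trans h1
        rw [Fin.natCast_eq_zero] at h2
        exact absurd (Nat.le_of_dvd (by omega) h2) (by omega)
      have := (hl (i + 1 + (k : Fin (n + 1)))).reachable_restrict
        (A := Set.range d \ {d i}) ⟨⟨_, rfl⟩, hne⟩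
      simpa [add_assoc] using this
  refine ⟨_, _, hl i, ?_⟩
  have := key n le_rfl
  have h0 : (1 : Fin (n + 1)) + (n : Fin (n + 1)) = 0 := by
    have : ((n + 1 : ℕ) : Fin (n + 1)) = 0 := by rw [Fin.natCast_eq_zero]
    push_cast at this
    exact (add_comm _ _).trans this
  rw [add_assoc, h0, add_zero] at this
  exact this.symm

lemma exists_isCycle_of_mem_edgeClosure (he : e ∈ G.edgeClosure A) (heA : e ∉ A) :
    ∃ C ⊆ insert e A, G.IsCycle C ∧ e ∈ C := by
  obtain ⟨x, y, hxy, hr⟩ := he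
  classical
  -- Only a path is needed, so loops and multiplicities may be forgotten here; each step of the path
  -- is lifted back to an edge of `A` below.
  let S : SimpleGraph α := SimpleGraph.fromRel (G.restrict A).Adj
  have hS : S.Reachable x y := by
    clear hxy
    induction hr with
    | refl => exact .refl _
    | @tail b c _ h ih =>
      by_cases hbc : b = c
      · rwa [← hbc]
      · exact ih.trans (SimpleGraph.Adj.reachable ((SimpleGraph.fromRel_adj _ _ _).2 ⟨hbc, .inl h⟩))
  obtain ⟨p, hp⟩ := hS.exists_isPath
  have hadj : ∀ i, i < p.length → ∃ d ∈ A, G.IsLink d (p.getVert i) (p.getVert (i + 1)) := by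
    intro i hi
    have := p.adj_getVert_succ hi
    obtain ⟨-, ⟨d, hd, h⟩ | ⟨d, hd, h⟩⟩ := (SimpleGraph.fromRel_adj _ _ _).1 this
    exacts [⟨d, hd, h⟩, ⟨d, hd, h.symm⟩]
  have : Nonempty ε := ⟨e⟩
  choose! d hdA hd using hadj
  have hinj : ∀ i j, i ≤ p.length → j ≤ p.length → p.getVert i = p.getVert j → i = j :=
    fun i j hi hj h => hp.getVert_injOn hi hj h
  -- The last index carries `e`, which closes the path up through the wrap-around of `Fin`. A loop
  -- is the case of length `0`.
  refine ⟨_, ?_, ⟨p.length, fun i => p.getVert i, fun i => if (i : ℕ) < p.length then d i else e,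
    ?_, ?_, ?_, rfl⟩, ⟨Fin.last _, by simp⟩⟩
  · rintro _ ⟨i, rfl⟩
    dsimp only
    split_ifs with h
    exacts [.inr (hdA _ h), .inl rfl]
  · intro i j h
    exact Fin.ext (hinj _ _ (by omega) (by omega) h)
  · intro i j h
    dsimp only at h
    split_ifs at h with hi hj hj
    · have hi' := hd _ hi
      rw [h] at hi'
      obtain ⟨h1, -⟩ | ⟨h1, h2⟩ := hi'.eq_and_eq_or_eq_and_eq (hd _ hj)
      · exact Fin.ext (hinj _ _ hi.le hj.le h1)
      · have h1 := hinj _ _ hi.le (by omega) h1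
        have h2 := hinj _ _ (by omega) hj.le h2
        omega
    · exact absurd (h ▸ hdA _ hi) heA
    · exact absurd (h ▸ hdA _ hj) heA
    · exact Fin.ext (by omega)
  · intro i
    dsimp only
    split_ifs with h
    · rw [Fin.val_add_one_of_lt (Fin.lt_def.2 h)]
      exact hd _ h
    · have hi : i = Fin.last _ := Fin.ext (by simp; omega)
      subst hi
      simpa using hxy.symm

lemma exists_isCycle_iff_mem_edgeClosure :
    (∃ C ⊆ insert e A, G.IsCycle C ∧ e ∈ C) ↔ e ∈ G.edgeClosure (A \ {e}) := by
  constructor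
  · rintro ⟨C, hCA, hC, heC⟩
    refine edgeClosure_mono ?_ (hC.mem_edgeClosure_diff heC)
    rintro f ⟨hf, hfe⟩
    exact ⟨(hCA hf).resolve_left hfe, hfe⟩
  · intro h
    obtain ⟨C, hCA, hC, heC⟩ := exists_isCycle_of_mem_edgeClosure h (by simp)
    exact ⟨C, hCA.trans (Set.insert_subset_insert Set.sdiff_subset), hC, heC⟩

lemma isSpanningForest_iff :
    G.IsSpanningForest F ↔ F ⊆ E(G) ∧ ∀ e ∈ F, e ∉ G.edgeClosure (F \ {e}) := by
  refine and_congr_right fun hF => ⟨fun h e he hc => ?_, fun h C hCF hC => ?_⟩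
  · obtain ⟨C, hCF, hC, -⟩ := exists_isCycle_iff_mem_edgeClosure.2 hc
    rw [Set.insert_eq_of_mem he] at hCF
    exact h C hCF hC
  · obtain ⟨e, he⟩ := hC.nonempty
    exact h e (hCF he) (edgeClosure_mono (Set.sdiff_subset_sdiff_left hCF)
      (hC.mem_edgeClosure_diff he))

lemma IsSpanningForest.subset (hF : G.IsSpanningForest F) (hA : A ⊆ F) : G.IsSpanningForest A :=
  ⟨hA.trans hF.1, fun C hC => hF.2 C (hC.trans hA)⟩

lemma isSpanningTree_iff :
    G.IsSpanningTree T ↔ G.IsSpanningForest T ∧ E(G) ⊆ G.edgeClosure T := by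
  refine and_congr_right fun hT => ⟨fun h e he => ?_, fun h x _ y _ hxy => ?_⟩
  · obtain ⟨x, y, hl⟩ := exists_isLink_of_mem_edgeSet he
    exact ⟨x, y, hl, h x hl.left_mem y hl.right_mem (Relation.ReflTransGen.single hl.adj)⟩
  · rw [← restrict_self G] at hxy
    exact hxy.of_subset_edgeClosure h

end Cycle

/-! ### Activities and the two greedy maps -/

section Activity

variable [LinearOrder ε] {G : Graph α ε} {A F T : Set ε} {e f : ε}

lemma mem_externallyActive_iff :
    e ∈ G.externallyActive F ↔ e ∉ F ∧ e ∈ G.edgeClosure (F ∩ Set.Ioi e) := by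
  constructor
  · rintro ⟨-, heF, C, hCF, hC, hCe, hmin⟩
    refine ⟨heF, edgeClosure_mono ?_ (hC.mem_edgeClosure_diff hCe)⟩
    rintro f ⟨hf, hfe⟩
    exact ⟨(hCF hf).resolve_left hfe, lt_of_le_of_ne (hmin hf) (Ne.symm hfe)⟩
  · rintro ⟨heF, he⟩
    obtain ⟨C, hCF, hC, heC⟩ := exists_isCycle_of_mem_edgeClosure he (by simp)
    refine ⟨edgeClosure_subset_edgeSet he, heF, C,
      hCF.trans (Set.insert_subset_insert Set.inter_subset_left), hC, heC, fun f hf => ?_⟩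
    obtain rfl | hf := hCF hf
    exacts [le_rfl, hf.2.le]

/-- Basis exchange: an edge not spanned by `T - e` can replace `e`, since a dependence in the new
set would have to involve `f`. -/
lemma IsSpanningTree.mem_cut_iff (hT : G.IsSpanningTree T) (he : e ∈ T) :
    f ∈ G.cut T e ↔ f ∈ E(G) ∧ f ∉ G.edgeClosure (T \ {e}) := by
  rw [isSpanningTree_iff] at hT
  obtain ⟨hF, hspan⟩ := hT
  have hT := isSpanningForest_iff.1 hF
  refine and_congr_right fun hf => ?_
  rw [isSpanningTree_iff, isSpanningForest_iff]
  constructor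
  · rintro ⟨-, h⟩ hfc
    refine hT.2 e he (edgeClosure_subset_edgeClosure ?_ (h (hT.1 he)))
    exact Set.insert_subset hfc (subset_edgeClosure (Set.sdiff_subset.trans hT.1))
  · intro hfc
    have hsub : insert f (T \ {e}) ⊆ E(G) := Set.insert_subset hf (Set.sdiff_subset.trans hT.1)
    refine ⟨⟨hsub, ?_⟩, hspan.trans (edgeClosure_subset_edgeClosure ?_)⟩
    · rintro g (rfl | hg) hgc
      · exact hfc (edgeClosure_mono (by grind) hgc)
      · by_cases hgf : g = f
        · subst hgf
          exact hfc (edgeClosure_mono (by grind) hgc)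
        have hgc' : g ∈ G.edgeClosure (insert f ((T \ {e}) \ {g})) :=
          edgeClosure_mono (by grind) hgc
        have hgn : g ∉ G.edgeClosure ((T \ {e}) \ {g}) := fun h =>
          hT.2 g hg.1 (edgeClosure_mono (by grind) h)
        exact hfc (edgeClosure_mono (by grind) (mem_edgeClosure_exchange hgc' hgn))
    · intro g hg
      by_cases hge : g = e
      · subst hge
        refine mem_edgeClosure_exchange (f := f) ?_ hfc
        exact edgeClosure_mono (by grind) (hspan hf)
      · exact subset_edgeClosure hsub (.inr ⟨hg, hge⟩)

lemma IsSpanningTree.notMem_internallyInactive_iff (hT : G.IsSpanningTree T) (he : e ∈ T) :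
    e ∉ G.internallyInactive T ↔ E(G) ∩ Set.Iio e ⊆ G.edgeClosure (T \ {e}) := by
  have hF := isSpanningForest_iff.1 hT.1
  have : e ∉ G.internallyInactive T ↔ IsLeast (G.cut T e) e := by
    simp [internallyInactive, he]
  rw [this]
  constructor
  · rintro ⟨-, h⟩ f ⟨hf, hfe⟩
    by_contra hc
    exact absurd (h ((hT.mem_cut_iff he).2 ⟨hf, hc⟩)) (not_le.2 hfe)
  · refine fun h => ⟨(hT.mem_cut_iff he).2 ⟨hF.1 he, hF.2 e he⟩, fun f hf => ?_⟩
    rw [hT.mem_cut_iff he] at hf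
    by_contra! hc
    exact hf.2 (h ⟨hf.1, hc⟩)

variable (G) in
/-- The spanning forest of `(V(G), A)` that is obtained by deleting the smallest edge of every
cycle. -/
def greatestForest (A : Set ε) : Set ε := {e | e ∈ A ∧ e ∉ G.edgeClosure (A ∩ Set.Ioi e)}

variable (G) in
/-- The spanning tree of `G` that is obtained from the spanning forest `F` by adding edges
greedily, the smallest first. -/
def leastTree (F : Set ε) : Set ε := F ∪ {e | e ∈ E(G) ∧ e ∉ G.edgeClosure (F ∪ E(G) ∩ Set.Iio e)}

/-- An externally active edge is spanned by the larger edges of `F`. Hence, above any `e`, the sets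
`A` and `F` have the same closure, and the greedy test gives the same answer for both. -/
lemma IsSpanningForest.eq_greatestForest (hF : G.IsSpanningForest F) (hFA : F ⊆ A)
    (hA : A ⊆ F ∪ G.externallyActive F) : F = G.greatestForest A := by
  have hF' := isSpanningForest_iff.1 hF
  have hcl : ∀ e, A ∩ Set.Ioi e ⊆ G.edgeClosure (F ∩ Set.Ioi e) := by
    rintro e a ⟨ha, hea⟩
    obtain ha | ha := hA ha
    · exact subset_edgeClosure (Set.inter_subset_left.trans hF.1) ⟨ha, hea⟩
    · exact edgeClosure_mono (Set.inter_subset_inter_right _ (Set.Ioi_subset_Ioi (le_of_lt hea)))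
        (mem_externallyActive_iff.1 ha).2
  ext e
  constructor
  · intro he
    refine ⟨hFA he, fun hc => hF'.2 e he ?_⟩
    refine edgeClosure_mono ?_ (edgeClosure_subset_edgeClosure (hcl e) hc)
    exact fun f hf => ⟨hf.1, ne_of_gt hf.2⟩
  · rintro ⟨he, hc⟩
    refine (hA he).resolve_right fun h => hc ?_
    exact edgeClosure_mono (Set.inter_subset_inter_left _ hFA) (mem_externallyActive_iff.1 h).2

lemma greatestForest_subset : G.greatestForest A ⊆ A := fun _ h => h.1

lemma isSpanningForest_greatestForest (hA : A ⊆ E(G)) :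
    G.IsSpanningForest (G.greatestForest A) := by
  refine ⟨greatestForest_subset.trans hA, fun C hCF hC => ?_⟩
  obtain ⟨e, he, hmin⟩ := hC.finite.exists_minimal hC.nonempty
  refine (hCF he).2 (edgeClosure_mono ?_ (hC.mem_edgeClosure_diff he))
  rintro f ⟨hf, hfe⟩
  refine ⟨(hCF hf).1, lt_of_le_of_ne ?_ (Ne.symm hfe)⟩
  exact (le_total e f).elim id (hmin hf)

lemma subset_greatestForest_union (hE : E(G).Finite) (hA : A ⊆ E(G)) :
    A ⊆ G.greatestForest A ∪ G.externallyActive (G.greatestForest A) := by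
  have key : ∀ e ∈ A, e ∈ G.greatestForest A ∨
      e ∈ G.edgeClosure (G.greatestForest A ∩ Set.Ioi e) := by
    intro e he
    -- Induction from the largest edge down: larger edges of `A` are already spanned by retained
    -- edges no smaller than themselves.
    refine ((hE.subset hA).wellFoundedOn (r := (· > ·))).induction (P := fun e =>
      e ∈ G.greatestForest A ∨ e ∈ G.edgeClosure (G.greatestForest A ∩ Set.Ioi e)) he
      fun e he ih => ?_
    by_cases hc : e ∈ G.edgeClosure (A ∩ Set.Ioi e)
    · refine .inr (edgeClosure_subset_edgeClosure ?_ hc)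
      rintro f ⟨hf, hef⟩
      obtain h | h := ih f hf hef
      · exact subset_edgeClosure (Set.inter_subset_left.trans (greatestForest_subset.trans hA))
          ⟨h, hef⟩
      · exact edgeClosure_mono
          (Set.inter_subset_inter_right _ (Set.Ioi_subset_Ioi (le_of_lt hef))) h
    · exact .inl ⟨he, hc⟩
  intro e he
  by_cases h : e ∈ G.greatestForest A
  · exact .inl h
  · exact .inr (mem_externallyActive_iff.2 ⟨h, (key e he).resolve_left h⟩)

/-- Edges of `T` outside `F` are internally active, so `T - e` spans everything below such an `e`
and the greedy procedure accepts `e`. An edge outside `T` is rejected because the rest of its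
fundamental cycle lies in `F` or below it. -/
lemma IsSpanningTree.eq_leastTree (hT : G.IsSpanningTree T) (hFT : F ⊆ T)
    (hF : G.internallyInactive T ⊆ F) : T = G.leastTree F := by
  have hT' := isSpanningForest_iff.1 hT.1
  have hact : ∀ e ∈ T, e ∉ F → E(G) ∩ Set.Iio e ⊆ G.edgeClosure (T \ {e}) := fun e he heF =>
    (hT.notMem_internallyInactive_iff he).1 fun h => heF (hF h)
  ext e
  constructor
  · intro he
    by_cases heF : e ∈ F
    · exact .inl heF
    · refine .inr ⟨hT'.1 he, fun hc => hT'.2 e he (edgeClosure_subset_edgeClosure ?_ hc)⟩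
      refine Set.union_subset (fun f hf => ?_) (hact e he heF)
      refine subset_edgeClosure (Set.sdiff_subset.trans hT'.1) ⟨hFT hf, ?_⟩
      rintro rfl
      exact heF hf
  · rintro (he | ⟨he, hc⟩)
    · exact hFT he
    · by_contra heT
      obtain ⟨C, hCT, hC, heC⟩ := exists_isCycle_of_mem_edgeClosure
        ((isSpanningTree_iff.1 hT).2 he) heT
      refine hc (edgeClosure_mono ?_ (hC.mem_edgeClosure_diff heC))
      rintro t ⟨ht, hte⟩
      have htT : t ∈ T := (hCT ht).resolve_left hte
      by_cases htF : t ∈ F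
      · exact .inl htF
      refine .inr ⟨hT'.1 htT, ?_⟩
      rw [Set.mem_Iio]
      by_contra! hle
      have hlt : e < t := lt_of_le_of_ne hle (Ne.symm hte)
      -- Activity of `t` puts the smaller edge `e` in the closure of `T - t`; the cycle then puts
      -- `t` there too, against acyclicity.
      refine hT'.2 t htT (edgeClosure_subset_edgeClosure ?_ (hC.mem_edgeClosure_diff ht))
      rintro g ⟨hg, hgt⟩
      obtain rfl | hgT := hCT hg
      · exact hact t htT htF ⟨he, hlt⟩
      · exact subset_edgeClosure (Set.sdiff_subset.trans hT'.1) ⟨hgT, hgt⟩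

lemma subset_leastTree : F ⊆ G.leastTree F := Set.subset_union_left

/-- Beyond spanning, the bound by `e` shows that every added edge is internally active: smaller
edges are spanned without it. -/
lemma mem_edgeClosure_leastTree (hE : E(G).Finite) (hF : F ⊆ E(G)) (he : e ∈ E(G)) :
    e ∈ G.edgeClosure (G.leastTree F ∩ (F ∪ Set.Iic e)) := by
  have hsub : ∀ e, G.leastTree F ∩ (F ∪ Set.Iic e) ⊆ E(G) := fun e f hf =>
    hf.1.elim (fun h => hF h) fun h => h.1
  refine (hE.wellFoundedOn (r := (· < ·))).induction (P := fun e =>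
    e ∈ G.edgeClosure (G.leastTree F ∩ (F ∪ Set.Iic e))) he fun e he ih => ?_
  by_cases hc : e ∈ G.edgeClosure (F ∪ E(G) ∩ Set.Iio e)
  · refine edgeClosure_subset_edgeClosure (Set.union_subset (fun f hf => ?_) ?_) hc
    · exact subset_edgeClosure (hsub e) ⟨.inl hf, .inl hf⟩
    · rintro f ⟨hf, hfe⟩
      exact edgeClosure_mono (Set.inter_subset_inter_right _
        (Set.union_subset_union_right _ (Set.Iic_subset_Iic.2 (le_of_lt hfe)))) (ih f hf hfe)
  · exact subset_edgeClosure (hsub e) ⟨.inr ⟨he, hc⟩, .inr le_rfl⟩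

lemma IsSpanningForest.isSpanningTree_leastTree (hE : E(G).Finite) (hF : G.IsSpanningForest F) :
    G.IsSpanningTree (G.leastTree F) := by
  have hsub : G.leastTree F ⊆ E(G) := Set.union_subset hF.1 fun f hf => hf.1
  refine isSpanningTree_iff.2 ⟨⟨hsub, fun C hCT hC => ?_⟩, fun e he =>
    edgeClosure_mono Set.inter_subset_left (mem_edgeClosure_leastTree hE hF.1 he)⟩
  by_cases hCF : (C \ F).Nonempty
  · obtain ⟨e, ⟨he, heF⟩, hmax⟩ := (hC.finite.subset Set.sdiff_subset).exists_maximal hCF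
    refine ((hCT he).resolve_left heF).2 (edgeClosure_mono ?_ (hC.mem_edgeClosure_diff he))
    rintro f ⟨hf, hfe⟩
    by_cases hfF : f ∈ F
    · exact .inl hfF
    · exact .inr ⟨hsub (hCT hf), lt_of_le_of_ne ((le_total f e).elim id (hmax ⟨hf, hfF⟩)) hfe⟩
  · exact hF.2 C (by rwa [Set.not_nonempty_iff_eq_empty, Set.sdiff_eq_empty] at hCF) hC

lemma IsSpanningForest.internallyInactive_leastTree_subset (hE : E(G).Finite)
    (hF : G.IsSpanningForest F) : G.internallyInactive (G.leastTree F) ⊆ F := by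
  have hT := hF.isSpanningTree_leastTree hE
  intro e he
  by_contra heF
  refine (hT.notMem_internallyInactive_iff he.1).2 ?_ he
  rintro f ⟨hf, hfe⟩
  refine edgeClosure_mono ?_ (mem_edgeClosure_leastTree hE hF.1 hf)
  rintro g ⟨hg, hg'⟩
  refine ⟨hg, ?_⟩
  rintro rfl
  exact hg'.elim heF fun h => absurd hfe (not_lt.2 h)

/-- The fundamental cycle of an externally active `e` avoids `T \ F`: an edge `t` of it there would
exceed `e` and be internally active, so `T - t` would span `e` and hence `t`. -/
lemma IsSpanningTree.externallyActive_eq (hT : G.IsSpanningTree T) (hFT : F ⊆ T)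
    (hF : G.internallyInactive T ⊆ F) : G.externallyActive F = G.externallyActive T := by
  have hT' := isSpanningForest_iff.1 hT.1
  ext e
  constructor
  · rintro ⟨he, heF, C, hCF, hC⟩
    have hCT := hCF.trans (Set.insert_subset_insert hFT)
    refine ⟨he, fun heT => hT.1.2 C ?_ hC.1, C, hCT, hC⟩
    rwa [Set.insert_eq_of_mem heT] at hCT
  · rintro ⟨he, heT, C, hCT, hC, heC, hmin⟩
    refine ⟨he, fun h => heT (hFT h), C, fun t ht => ?_, hC, heC, hmin⟩
    obtain rfl | htT := hCT ht
    · exact .inl rfl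
    refine .inr (by_contra fun htF => ?_)
    have hte : e < t := lt_of_le_of_ne (hmin ht) (by rintro rfl; exact heT htT)
    have hact := (hT.notMem_internallyInactive_iff htT).1 fun h => htF (hF h)
    refine hT'.2 t htT (edgeClosure_subset_edgeClosure ?_ (hC.mem_edgeClosure_diff ht))
    rintro g ⟨hg, hgt⟩
    obtain rfl | hgT := hCT hg
    · exact hact ⟨he, hte⟩
    · exact subset_edgeClosure (Set.sdiff_subset.trans hT'.1) ⟨hgT, hgt⟩

end Activity

/-! ### Sums over fibres and over intervals of sets -/

section Finsum

variable {ι κ R : Type*}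

lemma finsum_mem_fiberwise [AddCommMonoid R] {s : Set ι} {t : Set κ} (hs : s.Finite)
    (ht : t.Finite) {g : ι → κ} (hg : Set.MapsTo g s t) (f : ι → R) :
    ∑ᶠ i ∈ s, f i = ∑ᶠ k ∈ t, ∑ᶠ i ∈ {i | i ∈ s ∧ g i = k}, f i := by
  classical
  rw [finsum_mem_eq_finite_toFinset_sum f hs, finsum_mem_eq_finite_toFinset_sum _ ht,
    ← Finset.sum_fiberwise_of_maps_to (t := ht.toFinset) (g := g) (fun i hi => by simpa using hg (by simpa using hi))]
  refine Finset.sum_congr rfl fun k _ => ?_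
  rw [← finsum_mem_coe_finset]
  simp

lemma finsum_mem_Icc_pow_ncard [CommSemiring R] {F X : Set ι} (hF : F.Finite) (hX : X.Finite)
    (hFX : Disjoint F X) (w : R) :
    ∑ᶠ A ∈ Set.Icc F (F ∪ X), w ^ A.ncard = w ^ F.ncard * (w + 1) ^ X.ncard := by
  classical
  have h := Finset.sum_pow_mul_eq_add_pow w 1 hX.toFinset
  simp only [one_pow, mul_one] at h
  rw [Set.ncard_eq_toFinset_card X hX, ← h, Finset.mul_sum, ← finsum_mem_coe_finset]
  symm
  refine finsum_mem_eq_of_bijOn (fun Y : Finset ι => F ∪ (Y : Set ι)) ⟨?_, ?_, ?_⟩ ?_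
  · intro Y hY
    have hY : (Y : Set ι) ⊆ X := by simpa using hY
    exact ⟨Set.subset_union_left, Set.union_subset_union_right _ hY⟩
  · intro Y hY Z hZ h
    have hY : (Y : Set ι) ⊆ X := by simpa using hY
    have hZ : (Z : Set ι) ⊆ X := by simpa using hZ
    have h : F ∪ (Y : Set ι) = F ∪ Z := h
    rw [← Finset.coe_inj, ← (hFX.mono_right hY).sup_sdiff_cancel_left,
      ← (hFX.mono_right hZ).sup_sdiff_cancel_left]
    exact congrArg (· \ F) h
  · rintro A ⟨hFA, hA⟩
    refine ⟨(hX.subset (Set.sdiff_subset_iff.2 hA : A \ F ⊆ X)).toFinset, ?_, ?_⟩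
    · simpa using hA
    · simpa using hFA
  · intro Y hY
    have hY : (Y : Set ι) ⊆ X := by simpa using hY
    rw [Set.ncard_union_eq (hFX.mono_right hY) hF Y.finite_toSet, pow_add, Set.ncard_coe_finset]

end Finsum

/-! ### Random cluster expansion and constrained spin sums -/

section Spin

variable {G : Graph α ε} {A B F T : Set ε} {e f : ε} {x y : α} {q : ℕ} {β J : ℂ} {z : α → ℂ}

variable (G) in
/-- The spin configurations that are constant along each edge in `A`. -/
def constantOn (q : ℕ) (A : Set ε) : Set (V(G) → Fin q) :=
  {σ | ∀ e ∈ A, ∀ x y : V(G), G.IsLink e x y → σ x = σ y}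

variable (G) in
/-- The Boltzmann weight of the external field. -/
def fieldWeight (β : ℂ) (z : α → ℂ) (σ : V(G) → Fin q) : ℂ :=
  Complex.exp (β * ∑ᶠ v : V(G), z v * (if (σ v : ℕ) = 0 then 1 else 0))

variable (G) in
/-- The partition function of the external field, restricted to the spin configurations that are
constant along each edge in `A`. -/
def constrainedZ (q : ℕ) (β : ℂ) (z : α → ℂ) (A : Set ε) : ℂ :=
  ∑ᶠ σ ∈ G.constantOn q A, G.fieldWeight β z σ

/-- With `M` the set of monochromatic edges, the interaction contributes `(w + 1) ^ |M|`, the sum of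
`w ^ |A|` over `A ⊆ M`; and `A ⊆ M` says that `σ` is constant along `A`. -/
lemma exp_pottsHamiltonian (hE : E(G).Finite) (σ : V(G) → Fin q) :
    Complex.exp (-β * G.pottsHamiltonian J z σ) =
      ∑ᶠ A ∈ 𝒫 E(G), (Complex.exp (β * J) - 1) ^ A.ncard *
        Set.indicator (G.constantOn q A) (G.fieldWeight β z) σ := by
  classical
  set M : Set ε := {e | e ∈ E(G) ∧ ∀ x y : V(G), G.IsLink e x y → σ x = σ y} with hM
  have hMfin : M.Finite := hE.subset fun e he => he.1
  have hδ : ∑ᶠ e ∈ E(G), G.edgeDelta σ e = (M.ncard : ℂ) := by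
    rw [finsum_mem_eq_finite_toFinset_sum _ hE]
    simp only [edgeDelta]
    rw [Finset.sum_boole, Set.ncard_eq_toFinset_card M hMfin]
    congr 2
    ext e
    simp [hM]
  have h1 : Complex.exp (-β * G.pottsHamiltonian J z σ) =
      G.fieldWeight β z σ * Complex.exp (β * J) ^ M.ncard := by
    rw [pottsHamiltonian, fieldWeight, hδ, ← Complex.exp_nat_mul, ← Complex.exp_add]
    congr 1
    ring
  have h2 := finsum_mem_Icc_pow_ncard Set.finite_empty hMfin (Set.empty_disjoint M)
    (Complex.exp (β * J) - 1)
  rw [Set.empty_union, Set.ncard_empty, pow_zero, one_mul, sub_add_cancel] at h2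
  rw [h1, ← h2, mul_finsum_mem, finsum_mem_def, finsum_mem_def]
  refine finsum_congr fun A => ?_
  have hA : A ∈ Set.Icc ∅ M ↔ A ∈ 𝒫 E(G) ∧ σ ∈ G.constantOn q A :=
    ⟨fun h => ⟨fun e he => (h.2 he).1, fun e he => (h.2 he).2⟩,
      fun h => ⟨Set.empty_subset _, fun e he => ⟨h.1 he, h.2 e he⟩⟩⟩
  simp only [Set.indicator_apply, hA]
  by_cases h1 : A ∈ 𝒫 E(G) <;> by_cases h2 : σ ∈ G.constantOn q A <;> simp [h1, h2, mul_comm]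

lemma pottsZ_eq_finsum_constrainedZ (hV : V(G).Finite) (hE : E(G).Finite) :
    G.pottsZ q β J z = ∑ᶠ A ∈ 𝒫 E(G),
      (Complex.exp (β * J) - 1) ^ A.ncard * G.constrainedZ q β z A := by
  classical
  have := hV.fintype
  have hP : (𝒫 E(G)).Finite := hE.finite_subsets
  simp only [pottsZ, exp_pottsHamiltonian hE, constrainedZ]
  simp only [finsum_mem_eq_finite_toFinset_sum _ hP, finsum_eq_sum_of_fintype]
  rw [Finset.sum_comm]
  refine Finset.sum_congr rfl fun A _ => ?_
  rw [← Finset.mul_sum]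
  refine congrArg _ (Finset.sum_congr rfl fun σ _ => ?_)
  rw [finsum_eq_indicator_apply]

lemma Reachable.apply_eq {σ : V(G) → Fin q} (hσ : σ ∈ G.constantOn q A)
    (h : (G.restrict A).Reachable x y) (hx : x ∈ V(G)) (hy : y ∈ V(G)) :
    σ ⟨x, hx⟩ = σ ⟨y, hy⟩ := by
  have := h.of_rel (r := fun x y => ∀ hx : x ∈ V(G), ∃ hy : y ∈ V(G), σ ⟨x, hx⟩ = σ ⟨y, hy⟩)
    (fun x hx => ⟨hx, rfl⟩)
    (fun x y z h1 h2 hx => by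
      obtain ⟨hy, h1⟩ := h1 hx
      obtain ⟨hz, h2⟩ := h2 hy
      exact ⟨hz, h1.trans h2⟩)
    (fun e he x y hl hx => ⟨hl.right_mem, hσ e he ⟨x, hx⟩ ⟨y, hl.right_mem⟩ hl⟩)
  exact (this hx).2

lemma constantOn_mono (h : A ⊆ G.edgeClosure B) : G.constantOn q B ⊆ G.constantOn q A :=
  fun _ hσ _ he x y hl => (hl.mem_edgeClosure_iff.1 (h he)).apply_eq hσ x.2 y.2

lemma constrainedZ_union_eq (hA : A ⊆ E(G)) (hB : B ⊆ G.edgeClosure A) :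
    G.constrainedZ q β z (A ∪ B) = G.constrainedZ q β z A := by
  have : G.constantOn q (A ∪ B) = G.constantOn q A :=
    (constantOn_mono ((subset_edgeClosure (Set.union_subset hA
      (hB.trans edgeClosure_subset_edgeSet))).trans' Set.subset_union_left)).antisymm
      (constantOn_mono (Set.union_subset (subset_edgeClosure hA) hB))
  rw [constrainedZ, this, constrainedZ]

lemma constrainedZ_restrict (hA : A ⊆ T) :
    (G.restrict T).constrainedZ q β z A = G.constrainedZ q β z A := by
  have : (G.restrict T).constantOn q A = G.constantOn q A := by
    ext σ
    exact ⟨fun h e he x y hl => h e he x y ⟨hA he, hl⟩, fun h e he x y hl => h e he x y hl.2⟩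
  exact congrArg (fun s => ∑ᶠ σ ∈ s, G.fieldWeight β z σ) this

lemma constrainedZ_empty (hV : V(G).Finite) :
    G.constrainedZ q β z ∅ =
      ∏ᶠ v ∈ V(G), ∑ s : Fin q, Complex.exp (β * (z v * if (s : ℕ) = 0 then 1 else 0)) := by
  classical
  have := hV.fintype
  have h0 : G.constantOn q ∅ = Set.univ := by
    ext; simp [constantOn]
  rw [constrainedZ, h0, finsum_mem_univ, finsum_eq_sum_of_fintype,
    ← finprod_set_coe_eq_finprod_mem (f := fun v => ∑ s : Fin q,
      Complex.exp (β * (z v * if (s : ℕ) = 0 then 1 else 0))) V(G),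
    finprod_eq_prod_of_fintype, Finset.prod_univ_sum, Fintype.piFinset_univ]
  refine Finset.sum_congr rfl fun σ _ => ?_
  rw [fieldWeight, finsum_eq_sum_of_fintype, Finset.mul_sum, Complex.exp_sum]

lemma component_eq_iff (hx : x ∈ V(G)) :
    G.component x = G.component y ↔ G.Reachable x y := by
  constructor
  · intro h
    have : x ∈ G.component y := h ▸ ⟨hx, .refl _ _⟩
    exact this.2.symm
  · intro h
    ext v
    exact and_congr_right fun _ => ⟨h.symm.trans, h.trans⟩

/-- Configurations constant along `A` are those that factor through its components, and the fields
on a component add up because its spin is common. Disjointness matters since contraction deletes the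
edges in `A`. -/
lemma constrainedZ_contract (hV : V(G).Finite) (hAB : Disjoint A B) :
    (G.contract A).constrainedZ q β (mergedWeight z) B = G.constrainedZ q β z (A ∪ B) := by
  classical
  have := hV.fintype
  have hmem : ∀ v : V(G), (G.restrict A).component v ∈ V(G.contract A) := fun v =>
    ⟨v, v.2, rfl⟩
  have hVK : V(G.contract A).Finite := hV.image _
  have := hVK.fintype
  refine finsum_mem_eq_of_bijOn
    (fun τ v => τ ⟨(G.restrict A).component v, hmem v⟩) ⟨?_, ?_, ?_⟩ ?_
  · rintro τ hτ e (he | he) x y hl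
    · refine congrArg τ (Subtype.ext ?_)
      exact (component_eq_iff (G := G.restrict A) x.2).2 (hl.reachable_restrict he)
    · exact hτ e he _ _ ⟨x, y, ⟨hl, fun h => hAB.le_bot ⟨h, he⟩⟩, rfl, rfl⟩
  · intro τ _ τ' _ h
    ext1 ⟨S, v, hv, hS⟩
    subst hS
    exact congrFun h ⟨v, hv⟩
  · intro σ hσ
    have hrep : ∀ S : V(G.contract A), ∃ v : V(G), (G.restrict A).component v = S := by
      rintro ⟨S, v, hv, rfl⟩
      exact ⟨⟨v, hv⟩, rfl⟩
    choose r hr using hrep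
    have hσA : σ ∈ G.constantOn q A := fun e he => hσ e (.inl he)
    have hrσ : ∀ v : V(G), ∀ h, σ (r ⟨(G.restrict A).component v, h⟩) = σ v := by
      intro v h
      exact ((component_eq_iff (G := G.restrict A) (r _).2).1
        (hr ⟨(G.restrict A).component v, h⟩)).apply_eq hσA _ _
    refine ⟨fun S => σ (r S), ?_, ?_⟩
    · rintro e he ⟨S, hS⟩ ⟨S', hS'⟩ ⟨x, y, ⟨hl, -⟩, hx, hy⟩
      subst hx hy
      have h1 := hrσ ⟨x, hl.left_mem⟩ hS
      have h2 := hrσ ⟨y, hl.right_mem⟩ hS'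
      exact (h1.trans (hσ e (.inr he) ⟨x, hl.left_mem⟩ ⟨y, hl.right_mem⟩ hl)).trans h2.symm
    · ext1 v
      exact hrσ v _
  · intro τ _
    simp only [fieldWeight]
    congr 2
    rw [finsum_eq_sum_of_fintype, finsum_eq_sum_of_fintype,
      ← Finset.sum_fiberwise (s := Finset.univ)
        (g := fun v : V(G) => (⟨(G.restrict A).component v, hmem v⟩ : V(G.contract A)))]
    refine Finset.sum_congr rfl fun S _ => ?_
    have hS : mergedWeight z S = ∑ v ∈ Finset.univ.filter fun v : V(G) =>
        (⟨(G.restrict A).component v, hmem v⟩ : V(G.contract A)) = S, z v := by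
      rw [mergedWeight, ← finsum_mem_coe_finset]
      symm
      refine finsum_mem_eq_of_bijOn Subtype.val ⟨?_, Subtype.val_injective.injOn, ?_⟩
        fun _ _ => rfl
      · intro v hv
        rw [Finset.coe_filter] at hv
        rw [← hv.2]
        exact ⟨v.2, .refl _ _⟩
      · obtain ⟨S, w, hw, rfl⟩ := S
        intro v hv
        refine ⟨⟨v, hv.1⟩, ?_, rfl⟩
        rw [Finset.coe_filter]
        exact ⟨Finset.mem_univ _,
          Subtype.ext ((component_eq_iff (G := G.restrict A) hv.1).2 hv.2.symm)⟩
    rw [hS, Finset.sum_mul]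
    refine Finset.sum_congr rfl fun v hv => ?_
    obtain rfl := (Finset.mem_filter.1 hv).2
    rfl

end Spin

/-! ### Forest and tree expansions -/

section Expansion

variable {G : Graph α ε} {A B F T : Set ε} {q : ℕ} {β J H : ℂ} {z : α → ℂ}

lemma finprod_mem_const_eq_pow {ι R : Type*} [CommMonoid R] {s : Set ι} (hs : s.Finite) (c : R) :
    ∏ᶠ _i ∈ s, c = c ^ s.ncard := by
  rw [finprod_mem_eq_finite_toFinset_prod _ hs, Finset.prod_const, Set.ncard_eq_toFinset_card s hs]

lemma sum_exp_field (hq : 1 ≤ q) (β z : ℂ) :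
    ∑ s : Fin q, Complex.exp (β * (z * if (s : ℕ) = 0 then 1 else 0)) =
      Complex.exp (β * z) + q - 1 := by
  obtain ⟨k, rfl⟩ := Nat.exists_eq_add_of_le' hq
  rw [Fin.sum_univ_succ]
  simp
  ring

lemma mergedWeight_const {S : Set α} (hS : S.Finite) (H : ℂ) :
    mergedWeight (fun _ => H) S = H * S.ncard := by
  rw [mergedWeight, finsum_mem_eq_finite_toFinset_sum _ hS, Finset.sum_const, nsmul_eq_mul,
    Set.ncard_eq_toFinset_card S hS, mul_comm]

lemma components_finite (hV : V(G).Finite) : G.components.Finite := hV.image _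

lemma finite_of_mem_components (hV : V(G).Finite) {S : Set α} (hS : S ∈ G.components) :
    S.Finite := by
  obtain ⟨x, -, rfl⟩ := hS
  exact hV.subset fun y hy => hy.1

/-- Contracting all of `A` leaves no constraint, so the merged vertices are independent. -/
lemma constrainedZ_eq_finprod (hV : V(G).Finite) :
    G.constrainedZ q β z A = ∏ᶠ S ∈ (G.restrict A).components,
      ∑ s : Fin q, Complex.exp (β * (mergedWeight z S * if (s : ℕ) = 0 then 1 else 0)) := by
  have h := constrainedZ_contract (q := q) (β := β) (z := z) hV (Set.disjoint_empty A)
  rw [Set.union_empty] at h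
  rw [← h]
  exact constrainedZ_empty (hV.image _)

lemma constrainedZ_const (hV : V(G).Finite) (hq : 1 ≤ q) :
    G.constrainedZ q β (fun _ => H) A = ∏ᶠ S ∈ (G.restrict A).components,
      (Complex.exp (β * H * (S.ncard : ℂ)) + (q : ℂ) - 1) := by
  rw [constrainedZ_eq_finprod hV]
  refine finprod_mem_congr rfl fun S hS => ?_
  rw [sum_exp_field hq, mergedWeight_const (finite_of_mem_components (G := G.restrict A) hV hS),
    mul_assoc]

/-- Here `q = 0` must be allowed: the zero-field polynomial is tested at every natural number. -/
lemma constrainedZ_zero (hV : V(G).Finite) :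
    G.constrainedZ q β 0 A = (q : ℂ) ^ (G.restrict A).components.ncard := by
  rw [constrainedZ_eq_finprod hV, ← finprod_mem_const_eq_pow (components_finite (G := G.restrict A) hV)]
  refine finprod_mem_congr rfl fun S hS => ?_
  have : mergedWeight (0 : α → ℂ) S = 0 := by simp [mergedWeight]
  simp [this]

lemma pottsZ_eq_finsum_forest [LinearOrder ε] (hV : V(G).Finite) (hE : E(G).Finite) :
    G.pottsZ q β J z = ∑ᶠ F ∈ {F | G.IsSpanningForest F},
      (Complex.exp (β * J) - 1) ^ F.ncard * Complex.exp (β * J) ^ (G.externallyActive F).ncard *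
        G.constrainedZ q β z F := by
  have hP : (𝒫 E(G)).Finite := hE.finite_subsets
  rw [pottsZ_eq_finsum_constrainedZ hV hE, finsum_mem_fiberwise hP
    (hP.subset (s := 𝒫 E(G)) fun F (hF : G.IsSpanningForest F) => hF.1)
    (g := G.greatestForest) fun A hA => isSpanningForest_greatestForest hA]
  refine finsum_mem_congr rfl fun F (hF : G.IsSpanningForest F) => ?_
  have hEA : G.externallyActive F ⊆ E(G) := fun e he => he.1
  have hdisj : Disjoint F (G.externallyActive F) :=
    Set.disjoint_right.2 fun e he => he.2.1
  have hIcc : {A | A ∈ 𝒫 E(G) ∧ G.greatestForest A = F} =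
      Set.Icc F (F ∪ G.externallyActive F) := by
    ext A
    constructor
    · rintro ⟨hA, rfl⟩
      exact ⟨greatestForest_subset, subset_greatestForest_union hE hA⟩
    · rintro ⟨hFA, hA⟩
      exact ⟨hA.trans (Set.union_subset hF.1 hEA), (hF.eq_greatestForest hFA hA).symm⟩
  have hsum := finsum_mem_Icc_pow_ncard (hE.subset hF.1) (hE.subset hEA) hdisj
    (Complex.exp (β * J) - 1)
  rw [sub_add_cancel] at hsum
  rw [hIcc, ← hsum, finsum_mem_mul]
  refine finsum_mem_congr rfl fun A hA => ?_
  rw [← Set.union_sdiff_cancel hA.1, constrainedZ_union_eq hF.1]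
  refine (Set.sdiff_subset_iff.2 hA.2).trans fun e he => ?_
  exact edgeClosure_mono Set.inter_subset_left (mem_externallyActive_iff.1 he).2

/-- The contraction has edge set `T \ A`, so its random cluster sum is reindexed by `F = A ∪ B` with
`B ⊆ T \ A`. -/
lemma pottsZ_contract (hV : V(G).Finite) (hE : E(G).Finite) (hT : T ⊆ E(G)) (hA : A ⊆ T) :
    (Complex.exp (β * J) - 1) ^ A.ncard *
        ((G.restrict T).contract A).pottsZ q β J (mergedWeight z) =
      ∑ᶠ F ∈ Set.Icc A T, (Complex.exp (β * J) - 1) ^ F.ncard * G.constrainedZ q β z F := by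
  have hEK : E((G.restrict T).contract A) = T \ A :=
    congrArg (· \ A) (Set.inter_eq_self_of_subset_right hT)
  have hTfin := hE.subset hT
  rw [pottsZ_eq_finsum_constrainedZ (hV.image _) (hEK ▸ hTfin.subset Set.sdiff_subset), hEK,
    mul_finsum_mem]
  refine finsum_mem_eq_of_bijOn (fun B => A ∪ B) ⟨?_, ?_, ?_⟩ ?_
  · intro B hB
    exact ⟨Set.subset_union_left, Set.union_subset hA (hB.trans Set.sdiff_subset)⟩
  · intro B hB C hC h
    have hB' : Disjoint A B := (Set.disjoint_sdiff_right).mono_right hB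
    have hC' : Disjoint A C := (Set.disjoint_sdiff_right).mono_right hC
    rw [← hB'.sup_sdiff_cancel_left, ← hC'.sup_sdiff_cancel_left]
    exact congrArg (· \ A) h
  · rintro F ⟨hAF, hFT⟩
    exact ⟨F \ A, Set.sdiff_subset_sdiff_left hFT, Set.union_sdiff_cancel hAF⟩
  · intro B hB
    have hB' : Disjoint A B := (Set.disjoint_sdiff_right).mono_right hB
    have hBT : B ⊆ T := hB.trans Set.sdiff_subset
    rw [constrainedZ_contract (G := G.restrict T) hV hB',
      constrainedZ_restrict (Set.union_subset hA hBT),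
      Set.ncard_union_eq hB' (hTfin.subset hA) (hTfin.subset hBT), pow_add, mul_assoc]

lemma pottsZ_eq_finsum_tree [LinearOrder ε] (hV : V(G).Finite) (hE : E(G).Finite) :
    G.pottsZ q β J z = ∑ᶠ T ∈ {T | G.IsSpanningTree T},
      (Complex.exp (β * J) - 1) ^ (G.internallyInactive T).ncard *
        Complex.exp (β * J) ^ (G.externallyActive T).ncard *
        ((G.restrict T).contract (G.internallyInactive T)).pottsZ q β J (mergedWeight z) := by
  have hP : (𝒫 E(G)).Finite := hE.finite_subsets
  rw [pottsZ_eq_finsum_forest hV hE, finsum_mem_fiberwise (s := {F | G.IsSpanningForest F})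
    (hP.subset (s := 𝒫 E(G)) fun F (hF : G.IsSpanningForest F) => hF.1)
    (hP.subset (s := 𝒫 E(G)) fun T (hT : G.IsSpanningTree T) => hT.1.1)
    (g := G.leastTree) fun F (hF : G.IsSpanningForest F) => hF.isSpanningTree_leastTree hE]
  refine finsum_mem_congr rfl fun T (hT : G.IsSpanningTree T) => ?_
  have hIcc : {F | F ∈ {F | G.IsSpanningForest F} ∧ G.leastTree F = T} =
      Set.Icc (G.internallyInactive T) T := by
    ext F
    constructor
    · rintro ⟨hF, rfl⟩
      exact ⟨hF.internallyInactive_leastTree_subset hE, subset_leastTree⟩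
    · rintro ⟨hF, hFT⟩
      exact ⟨hT.1.subset hFT, (hT.eq_leastTree hFT hF).symm⟩
  rw [hIcc, mul_right_comm, pottsZ_contract hV hE hT.1.1 fun e he => he.1, finsum_mem_mul]
  refine finsum_mem_congr rfl fun F hF => ?_
  rw [hT.externallyActive_eq hF.2 hF.1]
  ring

end Expansion

/-! ### Connected partition expansion -/

section ConnectedPartition

variable {G : Graph α ε} {A : Set ε} {β J H w : ℂ}

lemma isConnected_iff_ncard_components : G.IsConnected ↔ G.components.ncard = 1 := by
  rw [Set.ncard_eq_one]
  constructor
  · rintro ⟨⟨x, hx⟩, h⟩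
    refine ⟨G.component x, Set.Subset.antisymm ?_ (by rintro _ rfl; exact ⟨x, hx, rfl⟩)⟩
    rintro _ ⟨y, hy, rfl⟩
    exact (component_eq_iff hy).2 (h y hy x hx)
  · rintro ⟨S, hS⟩
    have hcomp : ∀ x ∈ V(G), G.component x = S := fun x hx => by
      have : G.component x ∈ G.components := ⟨x, hx, rfl⟩
      rwa [hS] at this
    obtain ⟨x, hx, -⟩ : S ∈ G.components := hS ▸ rfl
    exact ⟨⟨x, hx⟩, fun y hy z hz => (component_eq_iff hy).1 ((hcomp y hy).trans (hcomp z hz).symm)⟩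

variable (G) in
/-- The partition of the vertex set into the vertex sets of the connected components. -/
def componentPartition : Partition V(G) where
  parts := G.components
  sSupIndep' := by
    rw [sSupIndep_iff_pairwiseDisjoint]
    rintro _ ⟨x, hx, rfl⟩ _ ⟨y, hy, rfl⟩ hne
    refine Set.disjoint_left.2 fun v hv hv' => hne ?_
    exact (component_eq_iff hx).2 (hv.2.trans hv'.2.symm)
  bot_notMem' := by
    rintro ⟨x, hx, h⟩
    have : x ∈ G.component x := ⟨hx, .refl _ _⟩
    rw [h] at this
    exact this
  sSup_eq' := by
    refine Set.Subset.antisymm (Set.sUnion_subset ?_) fun x hx => ⟨_, ⟨x, hx, rfl⟩, hx, .refl _ _⟩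
    rintro _ ⟨x, -, rfl⟩ y hy
    exact hy.1

/-- The right-hand side is a condition on each block separately, which makes the fibre over `π` a
product. -/
lemma componentPartition_restrict_eq_iff (hA : A ⊆ E(G)) (π : Partition V(G)) :
    (G.restrict A).componentPartition = π ↔
      (∀ e ∈ A, ∃ B ∈ π, e ∈ E(G.induce B)) ∧
        ∀ B ∈ π, ((G.induce B).restrict A).IsConnected := by
  constructor
  · rintro rfl
    constructor
    · intro e he
      obtain ⟨x, y, hl⟩ := exists_isLink_of_mem_edgeSet (hA he)
      exact ⟨_, ⟨x, hl.left_mem, rfl⟩, x, y, hl, ⟨hl.left_mem, .refl _ _⟩,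
        hl.right_mem, hl.reachable_restrict he⟩
    · rintro _ ⟨b, hb, rfl⟩
      refine ⟨⟨b, hb, .refl _ _⟩, fun x hx y hy => ?_⟩
      have := (hx.2.symm.trans hy.2).of_rel
        (r := fun u v => u ∈ (G.restrict A).component b → v ∈ (G.restrict A).component b ∧
          ((G.induce ((G.restrict A).component b)).restrict A).Reachable u v)
        (fun u hu => ⟨hu, .refl _ _⟩)
        (fun u v t huv hvt hu => ⟨(hvt (huv hu).1).1, (huv hu).2.trans (hvt (huv hu).1).2⟩)
        (fun e he u v hl hu => by
          have hv : v ∈ (G.restrict A).component b :=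
            ⟨hl.right_mem, hu.2.trans (hl.reachable_restrict he)⟩
          exact ⟨hv, IsLink.reachable_restrict (G := G.induce _) ⟨hl, hu, hv⟩ he⟩)
      exact (this hx).2
  · rintro ⟨hAπ, hconn⟩
    have hcomp : ∀ B ∈ π, ∀ x ∈ B, (G.restrict A).component x = B := by
      intro B hB x hx
      ext y
      constructor
      · rintro ⟨-, h⟩
        refine h.of_rel (r := fun u v => u ∈ B → v ∈ B) (fun _ => id)
          (fun _ _ _ h1 h2 h => h2 (h1 h)) (fun e he u v hl hu => ?_) hx
        obtain ⟨B', hB', x', y', hl', hx', hy'⟩ := hAπ e he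
        have : u ∈ B' ∧ v ∈ B' := by
          obtain ⟨rfl, rfl⟩ | ⟨rfl, rfl⟩ := hl.eq_and_eq_or_eq_and_eq hl'
          exacts [⟨hx', hy'⟩, ⟨hy', hx'⟩]
        rw [π.eq_of_mem_of_mem hB hB' hu this.1]
        exact this.2
      · intro hy
        refine ⟨π.subset_of_mem hB hy, ?_⟩
        exact ((hconn B hB).2 x hx y hy).of_rel (Reachable.refl _) (fun _ _ _ => .trans)
          fun e he u v (hl : (G.induce B).IsLink e u v) => hl.1.reachable_restrict he
    ext S
    constructor
    · rintro ⟨x, hx, rfl⟩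
      obtain ⟨B, hB, hxB⟩ := (π.mem_iff_exists).1 hx
      rwa [hcomp B hB x hxB]
    · intro hS
      obtain ⟨x, hx⟩ := π.nonempty_of_mem hS
      exact ⟨x, π.subset_of_mem hS hx, hcomp S hS x hx⟩

lemma disjoint_edgeSet_induce {π : Partition V(G)} {B B' : Set α} (hB : B ∈ π) (hB' : B' ∈ π)
    (hne : B ≠ B') : Disjoint E(G.induce B) E(G.induce B') := by
  refine Set.disjoint_left.2 ?_
  rintro e ⟨x, y, hl, hx, -⟩ ⟨x', y', hl', hx', hy'⟩
  obtain rfl | rfl := hl.left_eq_or_eq hl'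
  exacts [hne (π.eq_of_mem_of_mem hB hB' hx hx'), hne (π.eq_of_mem_of_mem hB hB' hx hy')]

lemma finite_edgeSet_induce (hE : E(G).Finite) (B : Set α) : E(G.induce B).Finite :=
  hE.subset fun _ ⟨_, _, hl, _⟩ => hl.edge_mem

lemma finite_partition {s : Set α} (hs : s.Finite) (π : Partition s) : (π : Set (Set α)).Finite :=
  hs.finite_subsets.subset fun _ hB => π.subset_of_mem hB

lemma finsum_componentPartition_eq (hV : V(G).Finite) (hE : E(G).Finite) (π : Partition V(G))
    (w : ℂ) :
    ∑ᶠ A ∈ {A | A ∈ 𝒫 E(G) ∧ (G.restrict A).componentPartition = π}, w ^ A.ncard =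
      ∏ᶠ B ∈ π, ∑ᶠ A ∈ {A | A ∈ 𝒫 E(G.induce B) ∧ ((G.induce B).restrict A).IsConnected},
        w ^ A.ncard := by
  classical
  have := (finite_partition hV π).fintype
  have hfin : ∀ B : Set α,
      {A | A ∈ 𝒫 E(G.induce B) ∧ ((G.induce B).restrict A).IsConnected}.Finite := fun B =>
    (finite_edgeSet_induce hE B).finite_subsets.subset fun A hA => hA.1
  have hdisj : ∀ B B' : (π : Set (Set α)), B ≠ B' →
      Disjoint E(G.induce (B : Set α)) E(G.induce B') := fun B B' h =>
    disjoint_edgeSet_induce B.2 B'.2 (Subtype.coe_injective.ne h)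
  -- Distinct blocks induce disjoint edge sets, so a family is recovered from its union by
  -- intersecting with each block.
  have hinter : ∀ p : ↥(π : Set (Set α)) → Set ε, (∀ B, p B ⊆ E(G.induce (B : Set α))) →
      ∀ B : ↥(π : Set (Set α)), E(G.induce (B : Set α)) ∩ ⋃ B, p B = p B := by
    intro p hp B
    ext e
    constructor
    · rintro ⟨he, h⟩
      obtain ⟨B', h⟩ := Set.mem_iUnion.1 h
      by_cases hBB : B = B'
      · rwa [hBB]
      · exact absurd (hp B' h) (Set.disjoint_left.1 (hdisj B B' hBB) he)
    · exact fun h => ⟨hp B h, Set.mem_iUnion.2 ⟨B, h⟩⟩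
  have hprod := finprod_set_coe_eq_finprod_mem (f := fun B => ∑ᶠ A ∈ {A | A ∈ 𝒫 E(G.induce B) ∧
    ((G.induce B).restrict A).IsConnected}, w ^ A.ncard) (π : Set (Set α))
  refine Eq.trans ?_ hprod
  rw [finprod_eq_prod_of_fintype]
  simp only [finsum_mem_eq_finite_toFinset_sum _ (hfin _)]
  rw [Finset.prod_univ_sum, ← finsum_mem_coe_finset]
  symm
  have hmem : ∀ p : ↥(π : Set (Set α)) → Set ε,
      p ∈ (Fintype.piFinset fun B : (π : Set (Set α)) => (hfin B).toFinset) ↔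
        ∀ B, p B ⊆ E(G.induce (B : Set α)) ∧
          ((G.induce (B : Set α)).restrict (p B)).IsConnected := by
    intro p
    simp
  refine finsum_mem_eq_of_bijOn (fun p => ⋃ B, p B) ⟨?_, ?_, ?_⟩ ?_
  · intro p hp
    have hp := (hmem p).1 hp
    have hsub : ⋃ B, p B ⊆ E(G) := Set.iUnion_subset fun B => (hp B).1.trans
      fun _ ⟨_, _, hl, _⟩ => hl.edge_mem
    refine ⟨hsub, (componentPartition_restrict_eq_iff hsub π).2 ⟨fun e he => ?_, fun B hB => ?_⟩⟩
    · obtain ⟨B, he⟩ := Set.mem_iUnion.1 he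
      exact ⟨B, B.2, (hp B).1 he⟩
    · rw [← restrict_edgeSet_inter]
      rw [hinter p (fun B => (hp B).1) ⟨B, hB⟩]
      exact (hp ⟨B, hB⟩).2
  · intro p hp p' hp' h
    have hp := (hmem p).1 hp
    have hp' := (hmem p').1 hp'
    have h : ⋃ B, p B = ⋃ B, p' B := h
    ext1 B
    rw [← hinter p (fun B => (hp B).1), ← hinter p' (fun B => (hp' B).1), h]
  · rintro A ⟨hA, hAπ⟩
    obtain ⟨h1, h2⟩ := (componentPartition_restrict_eq_iff hA π).1 hAπ
    refine ⟨fun B => E(G.induce (B : Set α)) ∩ A, (hmem _).2 fun B => ⟨Set.inter_subset_left, ?_⟩,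
      ?_⟩
    · rw [restrict_edgeSet_inter]
      exact h2 B B.2
    · refine Set.Subset.antisymm (Set.iUnion_subset fun B => Set.inter_subset_right) fun e he => ?_
      obtain ⟨B, hB, heB⟩ := h1 e he
      exact Set.mem_iUnion.2 ⟨⟨B, hB⟩, heB, he⟩
  · intro p hp
    have hp := (hmem p).1 hp
    rw [Finset.prod_pow_eq_pow_sum, ← finsum_eq_sum_of_fintype, Set.ncard_iUnion_of_finite]
    · exact fun B => (finite_edgeSet_induce hE _).subset (hp B).1
    · exact fun B B' h => (hdisj B B' h).mono (hp B).1 (hp B').1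

variable (G) in
/-- The random cluster expansion of the zero-field partition function, as a polynomial in the number
of spins. -/
def zeroFieldPolynomial (w : ℂ) : ℂ[X] :=
  ∑ᶠ A ∈ 𝒫 E(G), Polynomial.C (w ^ A.ncard) * Polynomial.X ^ (G.restrict A).components.ncard

lemma isZeroFieldPolynomial_zeroFieldPolynomial (hV : V(G).Finite) (hE : E(G).Finite) :
    G.IsZeroFieldPolynomial β J (G.zeroFieldPolynomial (Complex.exp (β * J) - 1)) := by
  intro n
  have hP : (𝒫 E(G)).Finite := hE.finite_subsets
  rw [pottsZ_eq_finsum_constrainedZ hV hE, zeroFieldPolynomial,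
    finsum_mem_eq_finite_toFinset_sum _ hP, finsum_mem_eq_finite_toFinset_sum _ hP,
    Polynomial.eval_finsetSum]
  refine Finset.sum_congr rfl fun A _ => ?_
  rw [constrainedZ_zero hV]
  simp

/-- The exponent of `X` counts components, so degree one selects the connected spanning subgraphs.
-/
lemma coeff_one_zeroFieldPolynomial (hE : E(G).Finite) :
    (G.zeroFieldPolynomial w).coeff 1 =
      ∑ᶠ A ∈ {A | A ∈ 𝒫 E(G) ∧ (G.restrict A).IsConnected}, w ^ A.ncard := by
  classical
  have hP : (𝒫 E(G)).Finite := hE.finite_subsets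
  rw [zeroFieldPolynomial, finsum_mem_eq_finite_toFinset_sum _ hP, Polynomial.finsetSum_coeff,
    finsum_mem_eq_finite_toFinset_sum _ (hP.subset fun A hA => hA.1)]
  simp only [Polynomial.coeff_C_mul, Polynomial.coeff_X_pow, mul_ite, mul_one, mul_zero,
    isConnected_iff_ncard_components]
  rw [← Finset.sum_filter]
  refine Finset.sum_congr ?_ fun _ _ => rfl
  ext A
  simp [eq_comm]

lemma IsConnected.of_restrict (h : (G.restrict A).IsConnected) : G.IsConnected :=
  ⟨h.1, fun x hx y hy => (h.2 x hx y hy).of_rel (Reachable.refl _) (fun _ _ _ => .trans)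
    fun _ _ _ _ hl => Relation.ReflTransGen.single hl.adj⟩

lemma finite_setOf_partition {s : Set α} (hs : s.Finite) (t : Set (Partition s)) : t.Finite :=
  Set.Finite.of_finite_image (f := fun π : Partition s => (π : Set (Set α)))
    (hs.finite_subsets.finite_subsets.subset
      (by rintro _ ⟨π, -, rfl⟩ B hB; exact π.subset_of_mem hB))
    SetLike.coe_injective.injOn

lemma pottsZ_eq_finsum_connectedPartition (hV : V(G).Finite) (hE : E(G).Finite) {q : ℕ}
    (hq : 1 ≤ q) :
    G.pottsZ q β J (fun _ => H) = ∑ᶠ π ∈ {π | G.IsConnectedPartition π},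
      (∏ᶠ B ∈ π, (Complex.exp (β * H * (B.ncard : ℂ)) + (q : ℂ) - 1)) *
        ∏ᶠ B ∈ π, ((G.induce B).zeroFieldPolynomial (Complex.exp (β * J) - 1)).coeff 1 := by
  have hP : (𝒫 E(G)).Finite := hE.finite_subsets
  rw [pottsZ_eq_finsum_constrainedZ hV hE, finsum_mem_fiberwise hP (finite_setOf_partition hV
    {π | G.IsConnectedPartition π})
    (g := fun A => (G.restrict A).componentPartition) fun A hA B hB =>
      (((componentPartition_restrict_eq_iff hA _).1 rfl).2 B hB).of_restrict]
  refine finsum_mem_congr rfl fun π _ => ?_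
  simp only [coeff_one_zeroFieldPolynomial (finite_edgeSet_induce hE _)]
  rw [← finsum_componentPartition_eq hV hE, mul_finsum_mem]
  refine finsum_mem_congr rfl ?_
  rintro A ⟨-, rfl⟩
  -- The components of `(V(G), A)` are by definition the blocks of the partition, so this factor is
  -- the same on the whole fibre.
  rw [constrainedZ_const hV hq, mul_comm]
  rfl

end ConnectedPartition

end

end Graph

theorem mainTheorem8 {α ε : Type*} [LinearOrder ε] (G : Graph α ε)
    (hV : V(G).Finite) (hE : E(G).Finite) (q : ℕ) (hq : 1 ≤ q) (β J H : ℂ) :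
    -- connected partition expansion
    (∃ P : Set α → ℂ[X],
      (∀ B ⊆ V(G), (G.induce B).IsZeroFieldPolynomial β J (P B)) ∧
      G.pottsZ q β J (fun _ => H) =
        ∑ᶠ (π : Partition V(G)) (_ : G.IsConnectedPartition π),
          (∏ᶠ B ∈ π, (Complex.exp (β * H * (B.ncard : ℂ)) + (q : ℂ) - 1)) *
            ∏ᶠ B ∈ π, (P B).coeff 1) ∧
    -- spanning forest expansion
    (G.pottsZ q β J (fun _ => H) =
      ∑ᶠ (F : Set ε) (_ : G.IsSpanningForest F),
        (∏ᶠ S ∈ (G.restrict F).components,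
            (Complex.exp (β * H * (S.ncard : ℂ)) + (q : ℂ) - 1)) *
          (∏ᶠ _e ∈ F, (Complex.exp (β * J) - 1)) *
          ∏ᶠ _e ∈ G.externallyActive F, Complex.exp (β * J)) ∧
    -- spanning tree expansion
    (G.pottsZ q β J (fun _ => H) =
      ∑ᶠ (T : Set ε) (_ : G.IsSpanningTree T),
        (∏ᶠ _e ∈ G.internallyInactive T, (Complex.exp (β * J) - 1)) *
          (∏ᶠ _e ∈ G.externallyActive T, Complex.exp (β * J)) *
          ((G.restrict T).contract (G.internallyInactive T)).pottsZ q β J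
            (Graph.mergedWeight fun _ => H)) := by
  have hF : ∀ F, G.IsSpanningForest F → F.Finite := fun F hF => hE.subset hF.1
  have hEA : ∀ F, (G.externallyActive F).Finite := fun F => hE.subset fun e he => he.1
  refine ⟨⟨fun B => (G.induce B).zeroFieldPolynomial (Complex.exp (β * J) - 1), fun B hB =>
    Graph.isZeroFieldPolynomial_zeroFieldPolynomial (hV.subset hB)
      (Graph.finite_edgeSet_induce hE B), Graph.pottsZ_eq_finsum_connectedPartition hV hE hq⟩,
    ?_, ?_⟩
  · refine (Graph.pottsZ_eq_finsum_forest hV hE).trans (finsum_mem_congr rfl fun F hF' => ?_)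
    rw [Graph.finprod_mem_const_eq_pow (hF F hF'), Graph.finprod_mem_const_eq_pow (hEA F),
      Graph.constrainedZ_const hV hq]
    ring
  · refine (Graph.pottsZ_eq_finsum_tree hV hE).trans
      (finsum_mem_congr rfl fun T (hT : G.IsSpanningTree T) => ?_)
    rw [Graph.finprod_mem_const_eq_pow ((hF T hT.1).subset fun e he => he.1),
      Graph.finprod_mem_const_eq_pow (hEA T)]
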